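/- Let $\mathcal X$ be a real Hilbert space and let $g:\mathcal X\to\mathbb R$ be a convex differentiable function whose set of minimizers $\operatorname{argmin} g$ is nonempty. Let $t_0>0$, $\alpha,\beta,a>0$, $0<q<1$ and $q+1<p\le 2$, and assume $a\ge q(1-q)$ in the case $p=2$. Let $\delta:[t_0,+\infty)\to(0,+\infty)$ be non-decreasing and differentiable with $\lim_{t\to+\infty}\delta(t)=+\infty$, and suppose that there exists $K_1>0$ such that $t\,\dot\delta(t)<K_1\,\delta(t)$ for all sufficiently large $t$. Let $x:[t_0,+\infty)\to\mathcal X$ be a strong global solution of $$\ddot x(t)+\frac{\alpha}{t^q}\dot x(t)+\beta\nabla^2 g(x(t))\dot x(t)+\delta(t)\nabla g(x(t))+\frac{a}{t^p}x(t)=0,$$ that is, $x$ is differentiable, $\dot x$ is locally absolutely continuous, the Hessian $\nabla^2 g(x(t))$ (the Fréchet derivative of $\nabla g$ at $x(t)$) exists for every $t\ge t_0$, and the equation holds for almost every $t\ge t_0$. Then $x(t)$ converges weakly, as $t\to+\infty$, to an element of $\operatorname{argmin} g$. Moreover, for every $x^*\in\operatorname{argmin} g$, as $t\to+\infty$, $$g(x(t))-g(x^*)=o\!\left(\frac{1}{\delta(t)\,t^{2q}}\right)\quad\text{and}\quad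 \|\dot x(t)+\beta\nabla g(x(t))\|=o\!\left(\frac{1}{t^q}\right).$$ -/

import Mathlib

open Filter Topology Set MeasureTheory Asymptotics

/-- The set of (global) minimizers of `g`. -/
def argmin {X : Type*} (g : X → ℝ) : Set X := {z | ∀ y, g z ≤ g y}

/-- `f` is absolutely continuous on every compact interval `[t₀, T]`. -/
def LocallyACFrom {X : Type*} [PseudoMetricSpace X] (t₀ : ℝ) (f : ℝ → X) : Prop :=
  ∀ T, t₀ ≤ T → AbsolutelyContinuousOnInterval f t₀ T

/-- The time derivative on `[t₀, +∞)` (one-sided at `t₀`). -/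
noncomputable def timeDeriv {X : Type*} [NormedAddCommGroup X] [NormedSpace ℝ X]
    (t₀ : ℝ) (f : ℝ → X) (t : ℝ) : X := derivWithin f (Ici t₀) t

/-- `x : [t₀, +∞) → X` is a strong global solution of
`x'' + (α / t^q) x' + β ∇²g(x) x' + δ(t) ∇g(x) + (a / t^p) x = 0`:
`x` is differentiable, `x'` is locally absolutely continuous, the Hessian `∇²g` (the Fréchet
derivative of the gradient) exists along the trajectory, and the equation holds
for almost every `t ≥ t₀`. -/
structure IsStrongGlobalSolution {X : Type*} [NormedAddCommGroup X] [InnerProductSpace ℝ X]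
    [CompleteSpace X] (g : X → ℝ) (δ : ℝ → ℝ) (α β a p q t₀ : ℝ) (x : ℝ → X) : Prop where
  differentiable : DifferentiableOn ℝ x (Ici t₀)
  velocity_ac : LocallyACFrom t₀ (timeDeriv t₀ x)
  hessian_exists : ∀ t, t₀ ≤ t → DifferentiableAt ℝ (gradient g) (x t)
  equation : ∀ᵐ t ∂(volume.restrict (Ici t₀)),
    DifferentiableWithinAt ℝ (timeDeriv t₀ x) (Ici t₀) t ∧
    timeDeriv t₀ (timeDeriv t₀ x) t + (α / t ^ q) • timeDeriv t₀ x t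
      + β • fderiv ℝ (gradient g) (x t) (timeDeriv t₀ x t)
      + δ t • gradient g (x t) + (a / t ^ p) • x t = 0

/-! ### Regularity of the velocity plus the damped gradient -/

/-! Put `v = x' + β∇g(x)`. Then `v' = -(α/t^q) x' - δ∇g(x) - (a/t^p) x`, so the Hessian disappears.
For a minimizer `z` and `0 < b < α`, the energy `E_b` is eventually nonnegative. Convexity and the
growth bound on `δ` give `E_b' ≤ -κ t^(-q) W + C t^(q-p)` (`energyDeriv_le`), where `W = t^(2q) (δ
(g(x) - g(z)) + ‖v‖²/2)`. Since `q - p < -1`, the error is integrable and `E_b` converges for every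
such `b`.

The energy is affine in `b`: `E_b = W + b B + o(1)`. Two values of `b` therefore give limits of `B`
and of `W` (`tendsto_of_energy`). As `t^(-q)` is not integrable, the limit of `W` is zero
(`limit_nonpos_of_deriv_le`), which contains both rates. What survives in `B` is `(α/2)‖x - z‖²`, so
distances to minimizers converge. Since also `g(x) → min g` and `g` is weakly lower semicontinuous,
Opial's lemma gives weak convergence. -/

theorem AbsolutelyContinuousOnInterval.clm_comp {E F : Type*} [NormedAddCommGroup E]
    [NormedSpace ℝ E] [NormedAddCommGroup F] [NormedSpace ℝ F] {f : ℝ → E} {a b : ℝ}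
    (hf : AbsolutelyContinuousOnInterval f a b) (L : E →L[ℝ] F) :
    AbsolutelyContinuousOnInterval (fun t => L (f t)) a b := by
  apply squeeze_zero (fun t ↦ ?_) (fun t ↦ ?_) (by simpa using Tendsto.const_mul ‖L‖ hf)
  · exact Finset.sum_nonneg (fun i hi ↦ by positivity)
  · rw [Finset.mul_sum]
    gcongr with i hi
    exact L.dist_le_opNorm _ _

/-- If `f` is absolutely continuous, `h` is differentiable everywhere, and the sum of their
derivatives agrees almost everywhere with a continuous `F`, then `F` integrates to `f + h`. -/
theorem integral_eq_sub_of_ac_add_differentiable_real {f h h' F : ℝ → ℝ} {s T : ℝ} (hsT : s ≤ T)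
    (hf : AbsolutelyContinuousOnInterval f s T) (hh : ContinuousOn h (Icc s T))
    (hh' : ∀ t ∈ Ioo s T, HasDerivAt h (h' t) t) (hF : ContinuousOn F (Icc s T))
    (hfF : ∀ᵐ t, t ∈ Ioo s T → HasDerivAt f (F t - h' t) t) :
    ∫ t in s..T, F t = (f T + h T) - (f s + h s) := by
  have hFi : IntervalIntegrable F volume s T := hF.intervalIntegrable_of_Icc hsT
  have hfi := hf.intervalIntegrable_deriv
  -- Integrability of `h'` is not assumed. It follows because `h'` agrees almost everywhere with `F
  -- - deriv f`, and it is what the fundamental theorem for the everywhere differentiable `h` needs.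
  have hae : ∀ᵐ t, t ∈ uIoc s T → F t - deriv f t = h' t := by
    have hT : ∀ᵐ t : ℝ, t ≠ T := by simp [ae_iff, measure_singleton]
    filter_upwards [hfF, hT] with t ht htT hmem
    rw [uIoc_of_le hsT] at hmem
    rw [(ht ⟨hmem.1, lt_of_le_of_ne hmem.2 htT⟩).deriv]
    ring
  have hhi : IntervalIntegrable h' volume s T :=
    (hFi.sub hfi).congr_ae ((ae_restrict_iff' measurableSet_uIoc).2 hae)
  have h1 := intervalIntegral.integral_eq_sub_of_hasDerivAt_of_le hsT hh hh' hhi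
  have h2 := hf.integral_deriv_eq_sub
  have h3 := intervalIntegral.integral_congr_ae hae
  rw [intervalIntegral.integral_sub hFi hfi] at h3
  linarith

/-- Continuous functionals preserve all the hypotheses and separate points, so the scalar case
suffices. -/
theorem integral_eq_sub_of_ac_add_differentiable {X : Type*} [NormedAddCommGroup X]
    [NormedSpace ℝ X] [CompleteSpace X] {f h h' F : ℝ → X} {s T : ℝ} (hsT : s ≤ T)
    (hf : AbsolutelyContinuousOnInterval f s T) (hh : ContinuousOn h (Icc s T))
    (hh' : ∀ t ∈ Ioo s T, HasDerivAt h (h' t) t) (hF : ContinuousOn F (Icc s T))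
    (hfF : ∀ᵐ t, t ∈ Ioo s T → HasDerivAt f (F t - h' t) t) :
    ∫ t in s..T, F t = (f T + h T) - (f s + h s) := by
  refine (SeparatingDual.eq_iff_forall_dual_eq (R := ℝ)).2 fun L => ?_
  rw [← L.intervalIntegral_comp_comm (hF.intervalIntegrable_of_Icc hsT)]
  simp only [map_sub, map_add]
  refine integral_eq_sub_of_ac_add_differentiable_real hsT (hf.clm_comp L)
    (L.continuous.comp_continuousOn hh) (h' := fun t => L (h' t))
    (fun t ht => L.hasFDerivAt.comp_hasDerivAt t (hh' t ht)) (L.continuous.comp_continuousOn hF) ?_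
  filter_upwards [hfF] with t ht hmem
  rw [← map_sub]
  exact L.hasFDerivAt.comp_hasDerivAt t (ht hmem)

section Solution

variable {X : Type*} [NormedAddCommGroup X] [InnerProductSpace ℝ X] [CompleteSpace X]
  {g : X → ℝ} {δ : ℝ → ℝ} {α β a p q t₀ : ℝ} {x : ℝ → X}

theorem timeDeriv_eq_deriv {E : Type*} [NormedAddCommGroup E] [NormedSpace ℝ E] (f : ℝ → E)
    {t : ℝ} (ht : t₀ < t) : timeDeriv t₀ f t = deriv f t :=
  derivWithin_of_mem_nhds (Ici_mem_nhds ht)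

theorem DifferentiableOn.hasDerivAt_timeDeriv {E : Type*} [NormedAddCommGroup E]
    [NormedSpace ℝ E] {f : ℝ → E} (hf : DifferentiableOn ℝ f (Ici t₀)) {t : ℝ} (ht : t₀ < t) :
    HasDerivAt f (timeDeriv t₀ f t) t := by
  rw [timeDeriv_eq_deriv f ht]
  exact (hf.differentiableAt (Ici_mem_nhds ht)).hasDerivAt

/-- The combination `x' + β ∇g(x)` is continuously differentiable along a strong solution, and
the equation becomes a first-order identity that holds at every time. -/
theorem IsStrongGlobalSolution.hasDerivAt_velocity_add_gradient
    (hx : IsStrongGlobalSolution g δ α β a p q t₀ x) (ht₀ : 0 < t₀)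
    (hδ : ContinuousOn δ (Ici t₀)) {t : ℝ} (ht : t₀ < t) :
    HasDerivAt (fun t => timeDeriv t₀ x t + β • gradient g (x t))
      (-((α / t ^ q) • timeDeriv t₀ x t) - δ t • gradient g (x t) - (a / t ^ p) • x t) t := by
  set F : ℝ → X := fun t =>
    -((α / t ^ q) • timeDeriv t₀ x t) - δ t • gradient g (x t) - (a / t ^ p) • x t with hFdef
  have hxc : ContinuousOn x (Ici t₀) := hx.differentiable.continuousOn
  have hgc : ContinuousOn (fun t => gradient g (x t)) (Ici t₀) := fun t ht =>
    (hx.hessian_exists t ht).continuousAt.comp_continuousWithinAt (hxc t ht)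
  have hvc : ContinuousOn (timeDeriv t₀ x) (Ici t₀) := by
    intro t ht
    have h1 := (hx.velocity_ac (t + 1) (by have := mem_Ici.1 ht; linarith)).continuousOn
    rw [uIcc_of_le (by have := mem_Ici.1 ht; linarith)] at h1
    refine (h1 t ⟨ht, by linarith⟩).mono_of_mem_nhdsWithin ?_
    filter_upwards [self_mem_nhdsWithin, mem_nhdsWithin_of_mem_nhds (Iio_mem_nhds (lt_add_one t))]
      with s hs hs' using ⟨hs, le_of_lt hs'⟩
  have hpow : ∀ (c r : ℝ), ContinuousOn (fun t : ℝ => c / t ^ r) (Ici t₀) := fun c r =>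
    continuousOn_const.div
      (continuousOn_id.rpow_const fun t ht => Or.inl (ht₀.trans_le ht).ne')
      fun t ht => (Real.rpow_pos_of_pos (ht₀.trans_le ht) r).ne'
  have hFc : ContinuousOn F (Ici t₀) :=
    (((hpow α q).smul hvc).neg.sub (hδ.smul hgc)).sub ((hpow a p).smul hxc)
  have hgd : ∀ s, t₀ < s → HasDerivAt (fun t => β • gradient g (x t))
      (β • fderiv ℝ (gradient g) (x s) (timeDeriv t₀ x s)) s := fun s hs =>
    ((hx.hessian_exists s hs.le).hasFDerivAt.comp_hasDerivAt s
      (hx.differentiable.hasDerivAt_timeDeriv hs)).const_smul β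
  have hftc : ∀ T, t₀ ≤ T → (timeDeriv t₀ x T + β • gradient g (x T)) =
      (timeDeriv t₀ x t₀ + β • gradient g (x t₀)) + ∫ s in t₀..T, F s := by
    intro T hT
    rw [integral_eq_sub_of_ac_add_differentiable hT (hx.velocity_ac T hT)
      (h := fun t => β • gradient g (x t)) ((hgc.mono Icc_subset_Ici_self).const_smul β)
      (fun s hs => hgd s hs.1) (hFc.mono Icc_subset_Ici_self)]
    · abel
    · have := (ae_restrict_iff' measurableSet_Ici).1 hx.equation
      filter_upwards [this] with s hs hmem
      obtain ⟨h1, h2⟩ := hs hmem.1.le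
      have h3 := (h1.differentiableAt (Ici_mem_nhds hmem.1)).hasDerivAt
      rw [← timeDeriv_eq_deriv _ hmem.1] at h3
      convert h3 using 1
      simp only [hFdef]
      rw [← sub_eq_zero, ← neg_eq_zero, ← h2]
      abel
  -- The integrand is continuous, so the almost-everywhere equation, once integrated, can be
  -- differentiated at every time.
  have hmain : HasDerivAt (fun T => (timeDeriv t₀ x t₀ + β • gradient g (x t₀))
      + ∫ s in t₀..T, F s) (F t) t := by
    refine HasDerivAt.const_add _ (intervalIntegral.integral_hasDerivAt_right
      ((hFc.mono Icc_subset_Ici_self).intervalIntegrable_of_Icc ht.le) ?_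
      (hFc.continuousAt (Ici_mem_nhds ht)))
    exact (hFc.mono Ioi_subset_Ici_self).stronglyMeasurableAtFilter isOpen_Ioi t ht
  refine hmain.congr_of_eventuallyEq ?_
  filter_upwards [Ioi_mem_nhds ht] with T hT using hftc T (le_of_lt hT)

end Solution

/-! ### Convexity and weak convergence -/

theorem ConvexOn.add_inner_gradient_le {X : Type*} [NormedAddCommGroup X]
    [InnerProductSpace ℝ X] [CompleteSpace X] {g : X → ℝ} (hg : ConvexOn ℝ univ g) {x : X}
    (hd : DifferentiableAt ℝ g x) (y : X) : g x + inner ℝ (gradient g x) (y - x) ≤ g y := by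
  have hconv : ConvexOn ℝ univ (fun s : ℝ => g (AffineMap.lineMap x y s)) := by
    simpa using! hg.comp_affineMap (AffineMap.lineMap x y : ℝ →ᵃ[ℝ] X)
  have hder : HasDerivAt (fun s : ℝ => g (AffineMap.lineMap x y s))
      (inner ℝ (gradient g x) (y - x)) 0 := by
    have h1 : HasFDerivAt g (fderiv ℝ g x) (AffineMap.lineMap x y (0 : ℝ)) := by
      simpa using hd.hasFDerivAt
    have h2 := h1.comp_hasDerivAt (0 : ℝ) (AffineMap.hasDerivAt_lineMap (a := x) (b := y))
    simpa [Function.comp_def] using! h2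
  have := hconv.le_slope_of_hasDerivAt (mem_univ 0) (mem_univ 1) zero_lt_one hder
  simp only [slope, AffineMap.lineMap_apply_one, AffineMap.lineMap_apply_zero, sub_zero, inv_one,
    one_smul, vsub_eq_sub] at this
  linarith

/-- A bounded family in a Hilbert space has a weak limit along every ultrafilter. -/
theorem Ultrafilter.exists_weak_limit {X ι : Type*} [NormedAddCommGroup X]
    [InnerProductSpace ℝ X] [CompleteSpace X] (U : Ultrafilter ι) {x : ι → X} {M : ℝ}
    (hx : ∀ᶠ i in (U : Filter ι), ‖x i‖ ≤ M) :
    ∃ w, ∀ e, Tendsto (fun i => inner ℝ e (x i)) U (𝓝 (inner ℝ e w)) := by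
  have h1 : ∀ᶠ i in (U : Filter ι), StrongDual.toWeakDual (InnerProductSpace.toDual ℝ X (x i)) ∈
      (WeakDual.toStrongDual ⁻¹' Metric.closedBall (0 : StrongDual ℝ X) M) := by
    filter_upwards [hx] with i hi
    simpa using hi
  obtain ⟨φ, -, hφ⟩ := (WeakDual.isCompact_closedBall (𝕜 := ℝ) (0 : StrongDual ℝ X) M)
    |>.ultrafilter_le_nhds
    (U.map fun i => StrongDual.toWeakDual (InnerProductSpace.toDual ℝ X (x i)))
    (by
      rw [le_principal_iff, Ultrafilter.coe_map, Filter.mem_map]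
      exact h1)
  refine ⟨(InnerProductSpace.toDual ℝ X).symm (WeakDual.toStrongDual φ), fun e => ?_⟩
  have h2 := ((WeakDual.eval_continuous (𝕜 := ℝ) e).tendsto φ).comp hφ
  rw [real_inner_comm, InnerProductSpace.toDual_symm_apply]
  refine (tendsto_map'_iff.1 (by simpa [Ultrafilter.coe_map] using h2)).congr fun i => ?_
  simp [real_inner_comm]

/-- Opial's lemma, for ultrafilter limits. -/
theorem exists_tendsto_toWeakSpace_of_opial {X ι : Type*} [NormedAddCommGroup X]
    [InnerProductSpace ℝ X] [CompleteSpace X] {l : Filter ι} [NeBot l] {x : ι → X} {S : Set X}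
    (hS : S.Nonempty) (hdist : ∀ z ∈ S, ∃ r, Tendsto (fun i => ‖x i - z‖ ^ 2) l (𝓝 r))
    (hlim : ∀ (U : Ultrafilter ι) (w : X), (U : Filter ι) ≤ l →
      (∀ e, Tendsto (fun i => inner ℝ e (x i)) U (𝓝 (inner ℝ e w))) → w ∈ S) :
    ∃ z ∈ S, Tendsto (fun i => toWeakSpace ℝ X (x i)) l (𝓝 (toWeakSpace ℝ X z)) := by
  obtain ⟨M, hM⟩ : ∃ M, ∀ᶠ i in l, ‖x i‖ ≤ M := by
    obtain ⟨z, hz⟩ := hS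
    obtain ⟨r, hr⟩ := hdist z hz
    refine ⟨(r + 2) + ‖z‖, ?_⟩
    filter_upwards [hr.eventually (gt_mem_nhds (lt_add_one r))] with i hi
    have h1 : ‖x i‖ ≤ ‖x i - z‖ + ‖z‖ := by simpa using norm_add_le (x i - z) z
    nlinarith [sq_nonneg (‖x i - z‖ - 1), norm_nonneg (x i - z)]
  have hex : ∀ U : Ultrafilter ι, (U : Filter ι) ≤ l → ∃ w ∈ S,
      ∀ e, Tendsto (fun i => inner ℝ e (x i)) U (𝓝 (inner ℝ e w)) := fun U hU => by
    obtain ⟨w, hw⟩ := U.exists_weak_limit (hU hM)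
    exact ⟨w, hlim U w hU hw, hw⟩
  obtain ⟨z, hz, hzlim⟩ := hex (Ultrafilter.of l) (Ultrafilter.of_le l)
  refine ⟨z, hz, ?_⟩
  have key : ∀ e, Tendsto (fun i => inner ℝ e (x i)) l (𝓝 (inner ℝ e z)) := by
    intro e
    rw [tendsto_iff_ultrafilter]
    intro U hU
    obtain ⟨w, hw, hwlim⟩ := hex U hU
    suffices w = z by rw [← this]; exact hwlim e
    obtain ⟨r, hr⟩ := hdist z hz
    obtain ⟨r', hr'⟩ := hdist w hw
    -- By polarization this inner product is a combination of the two squared distances, hence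
    -- converges along all of `l`. Comparing its limits along the two ultrafilters gives `‖w - z‖² =
    -- 0`.
    have hconv : Tendsto (fun i => inner ℝ (w - z) (x i)) l
        (𝓝 ((r - r' + ‖w‖ ^ 2 - ‖z‖ ^ 2) / 2)) := by
      refine ((((hr.sub hr').add_const (‖w‖ ^ 2)).sub_const (‖z‖ ^ 2)).div_const 2).congr fun i => ?_
      rw [norm_sub_sq_real, norm_sub_sq_real, inner_sub_left, real_inner_comm w, real_inner_comm z]
      ring
    have e1 := tendsto_nhds_unique (hwlim (w - z)) (hconv.mono_left hU)
    have e2 := tendsto_nhds_unique (hzlim (w - z)) (hconv.mono_left (Ultrafilter.of_le l))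
    rw [← sub_eq_zero, ← inner_self_eq_zero (𝕜 := ℝ), inner_sub_right, e1, e2, sub_self]
  have hinj : Function.Injective (topDualPairing ℝ X).flip := fun y y' h =>
    (SeparatingDual.eq_iff_forall_dual_eq (R := ℝ)).2 fun L => by
      simpa using LinearMap.congr_fun h L
  refine (WeakBilin.tendsto_iff_forall_eval_tendsto _ hinj).2 fun L => ?_
  have := key ((InnerProductSpace.toDual ℝ X).symm L)
  simpa only [InnerProductSpace.toDual_symm_apply] using! this

/-- The tangent inequality at `w` bounds `g (x i)` below by an affine function of `x i`, which
passes to the weak limit. -/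
theorem mem_argmin_of_weak_limit {X ι : Type*} [NormedAddCommGroup X]
    [InnerProductSpace ℝ X] [CompleteSpace X] {g : X → ℝ} (hg : ConvexOn ℝ univ g)
    (hd : Differentiable ℝ g) {l : Filter ι} [NeBot l] {x : ι → X} {z w : X} (hz : z ∈ argmin g)
    (hgx : Tendsto (fun i => g (x i)) l (𝓝 (g z)))
    (hw : ∀ e, Tendsto (fun i => inner ℝ e (x i)) l (𝓝 (inner ℝ e w))) : w ∈ argmin g := by
  intro y
  refine le_trans ?_ (hz y)
  have h1 : Tendsto (fun i => g w + (inner ℝ (gradient g w) (x i) - inner ℝ (gradient g w) w)) l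
      (𝓝 (g w)) := by
    simpa using ((hw (gradient g w)).sub_const (inner ℝ (gradient g w) w)).const_add (g w)
  refine le_of_tendsto_of_tendsto' h1 hgx fun i => ?_
  rw [← inner_sub_right]
  exact hg.add_inner_gradient_le (hd w) (x i)

/-! ### Two limit lemmas for differential inequalities -/

theorem exists_tendsto_of_deriv_nonpos {H H' : ℝ → ℝ} (hH : ∀ᶠ t in atTop, HasDerivAt H (H' t) t)
    (hH' : ∀ᶠ t in atTop, H' t ≤ 0) (h0 : ∀ᶠ t in atTop, 0 ≤ H t) :
    ∃ L, Tendsto H atTop (𝓝 L) := by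
  obtain ⟨T, hT⟩ := eventually_atTop.1 (hH.and (hH'.and h0))
  have hanti : AntitoneOn H (Ici T) := by
    refine antitoneOn_of_deriv_nonpos (convex_Ici T)
      (fun t ht => (hT t ht).1.continuousAt.continuousWithinAt)
      (fun t ht => (hT t (interior_subset ht)).1.differentiableAt.differentiableWithinAt)
      fun t ht => ?_
    rw [(hT t (interior_subset ht)).1.deriv]
    exact (hT t (interior_subset ht)).2.1
  have hmax : Antitone fun t => H (max T t) := fun s t hst =>
    hanti (le_max_left T s) (le_max_left T t) (max_le_max_left T hst)
  have hbdd : BddBelow (range fun t => H (max T t)) :=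
    ⟨0, by rintro _ ⟨t, rfl⟩; exact (hT _ (le_max_left T t)).2.2⟩
  refine ⟨_, (tendsto_atTop_ciInf hmax hbdd).congr' ?_⟩
  filter_upwards [eventually_ge_atTop T] with t ht
  rw [max_eq_right ht]

/-- Adding the vanishing nonnegative term `C / (-(s + 1)) * t ^ (s + 1)`, whose derivative is `-C *
t ^ s`, absorbs the error and reduces to the monotone case. -/
theorem exists_tendsto_of_deriv_le_rpow {E E' : ℝ → ℝ} {C s : ℝ} (hs : s < -1) (hC : 0 ≤ C)
    (hE : ∀ᶠ t in atTop, HasDerivAt E (E' t) t) (hE' : ∀ᶠ t in atTop, E' t ≤ C * t ^ s)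
    (h0 : ∀ᶠ t in atTop, 0 ≤ E t) : ∃ L, Tendsto E atTop (𝓝 L) := by
  have hs1 : s + 1 < 0 := by linarith
  have hs1' : s + 1 ≠ 0 := hs1.ne
  obtain ⟨L, hL⟩ := exists_tendsto_of_deriv_nonpos
    (H := fun t => E t + C / (-(s + 1)) * t ^ (s + 1)) (H' := fun t => E' t - C * t ^ s)
    (by
      filter_upwards [hE, eventually_gt_atTop 0] with t ht ht0
      convert! ht.add ((Real.hasDerivAt_rpow_const (p := s + 1) (Or.inl ht0.ne')).const_mul
        (C / (-(s + 1)))) using 1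
      rw [add_sub_cancel_right, div_neg, neg_mul, ← mul_assoc, div_mul_cancel₀ _ hs1', sub_eq_add_neg])
    (by filter_upwards [hE'] with t ht using by linarith)
    (by
      filter_upwards [h0, eventually_gt_atTop 0] with t ht ht0
      have : 0 < -(s + 1) := by linarith
      positivity)
  have hR : Tendsto (fun t : ℝ => C / (-(s + 1)) * t ^ (s + 1)) atTop (𝓝 0) := by
    simpa using (tendsto_rpow_neg_atTop (y := -(s + 1)) (by linarith)).const_mul (C / (-(s + 1)))
  exact ⟨L - 0, (hL.sub hR).congr fun t => by ring⟩

/-- If a convergent nonnegative `E` satisfies `E' ≤ -κ W t^(-q) + C t^s` with `q < 1` and `s < -1`,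
then the limit of `W` is not positive, because `t^(-q)` is not integrable. -/
theorem limit_nonpos_of_deriv_le {E E' W : ℝ → ℝ} {C s q κ L ℓ : ℝ} (hs : s < -1) (hq : q < 1)
    (hκ : 0 < κ) (hE : ∀ᶠ t in atTop, HasDerivAt E (E' t) t)
    (hE' : ∀ᶠ t in atTop, E' t ≤ -(κ * (W t * t ^ (-q))) + C * t ^ s)
    (h0 : ∀ᶠ t in atTop, 0 ≤ E t) (hEl : Tendsto E atTop (𝓝 ℓ)) (hW : Tendsto W atTop (𝓝 L)) :
    L ≤ 0 := by
  by_contra! hL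
  -- Eventually `W ≥ L / 2`, so the dissipation is at least `2 m t^(-q)`. One half absorbs the
  -- error, as `s + q < 0`; the other makes `E + m / (1 - q) t^(1 - q)` nonincreasing, against its
  -- divergence.
  set m := κ * L / 4 with hm
  have hm0 : 0 < m := by positivity
  have hq1 : 0 < 1 - q := by linarith
  have hsmall : ∀ᶠ t : ℝ in atTop, C * t ^ (s + q) < m := by
    have : Tendsto (fun t : ℝ => C * t ^ (s + q)) atTop (𝓝 0) := by
      simpa using (tendsto_rpow_neg_atTop (y := -(s + q)) (by linarith)).const_mul C
    exact this.eventually (gt_mem_nhds hm0)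
  obtain ⟨ℓ', hℓ'⟩ := exists_tendsto_of_deriv_nonpos
    (H := fun t => E t + m / (1 - q) * t ^ (1 - q)) (H' := fun t => E' t + m * t ^ (-q))
    (by
      filter_upwards [hE, eventually_gt_atTop 0] with t ht ht0
      convert! ht.add ((Real.hasDerivAt_rpow_const (p := 1 - q) (Or.inl ht0.ne')).const_mul
        (m / (1 - q))) using 1
      rw [show 1 - q - 1 = -q by ring]
      field_simp)
    (by
      filter_upwards [hE', hsmall, hW.eventually (lt_mem_nhds (half_lt_self hL)),
        eventually_gt_atTop 0] with t h1 h2 h3 ht0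
      have h4 : 0 < t ^ (-q) := Real.rpow_pos_of_pos ht0 _
      have h5 : C * t ^ s = C * t ^ (s + q) * t ^ (-q) := by
        rw [mul_assoc, ← Real.rpow_add ht0]
        ring_nf
      have h6 : κ * (L / 2 * t ^ (-q)) ≤ κ * (W t * t ^ (-q)) := by gcongr
      have h7 : C * t ^ (s + q) * t ^ (-q) ≤ m * t ^ (-q) := by gcongr
      have h8 : κ * (L / 2 * t ^ (-q)) = 2 * (m * t ^ (-q)) := by rw [hm]; ring
      linarith)
    (by
      filter_upwards [h0, eventually_gt_atTop 0] with t ht ht0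
      positivity)
  have h1 : Tendsto (fun t : ℝ => m / (1 - q) * t ^ (1 - q)) atTop (𝓝 (ℓ' - ℓ)) :=
    (hℓ'.sub hEl).congr fun t => by ring
  exact not_tendsto_nhds_of_tendsto_atTop
    ((tendsto_rpow_atTop hq1).const_mul_atTop (by positivity)) _ h1

/-! ### The energy functional -/

section Energy

variable {X : Type*} [NormedAddCommGroup X] [InnerProductSpace ℝ X]

/-- The Lyapunov energy anchored at `z`, with parameter `b`; here `v` stands for
`x' + β ∇g(x)`. -/
noncomputable def energy (g : X → ℝ) (δ : ℝ → ℝ) (α β a p q : ℝ) (z : X) (b : ℝ) (x v : ℝ → X)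
    (t : ℝ) : ℝ :=
  (t ^ (2 * q) * δ t - (α - b) * β * t ^ q) * (g (x t) - g z)
    + 1 / 2 * ‖b • (x t - z) + t ^ q • v t‖ ^ 2
    + 1 / 2 * (b * (α - b - q * t ^ (q - 1))) * ‖x t - z‖ ^ 2
    + 1 / 2 * a * t ^ (2 * q - p) * ‖x t‖ ^ 2

/-- The time derivative of `energy` along a solution, at a time where `δ` has derivative `d`. -/
noncomputable def energyDeriv [CompleteSpace X] (g : X → ℝ) (δ : ℝ → ℝ) (α β a p q : ℝ) (z : X)
    (b : ℝ) (x v : ℝ → X) (t d : ℝ) : ℝ :=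
  (2 * q * t ^ (2 * q - 1) * δ t + t ^ (2 * q) * d - (α - b) * β * (q * t ^ (q - 1)))
      * (g (x t) - g z)
    - t ^ q * (t ^ q * δ t - (α - b) * β) * β * ‖gradient g (x t)‖ ^ 2
    - t ^ q * (α - b - q * t ^ (q - 1)) * ‖v t‖ ^ 2
    - b * (t ^ q * δ t - (α - b) * β) * inner ℝ (gradient g (x t)) (x t - z)
    - b * (α - b - q * t ^ (q - 1)) * β * inner ℝ (gradient g (x t)) (x t - z)
    - a * b * t ^ (q - p) * (‖x t‖ ^ 2 + ‖x t - z‖ ^ 2 - ‖z‖ ^ 2) / 2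
    + b * q * (1 - q) * t ^ (q - 2) * ‖x t - z‖ ^ 2 / 2
    - a * (p - 2 * q) * t ^ (2 * q - p - 1) * ‖x t‖ ^ 2 / 2
    - a * β * t ^ (2 * q - p) * (inner ℝ (gradient g (x t)) (x t - z)
      + inner ℝ (gradient g (x t)) z)

/-- Here `Q = t^q`, `P = t^(-p)`, `I = q t^(q-1)`, `D = δ(t)`, `w = x - z` and `u = ∇g(x)`. The
weights in the energy are chosen so that the products of `v` with `u`, `w` and `w + z` all cancel.
-/
theorem energy_cross_terms (w z u v : X) {Q : ℝ} (hQ : Q ≠ 0) (α β a b D P I : ℝ) :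
    Q * (Q * D - (α - b) * β) * inner ℝ u (v - β • u)
      + inner ℝ (b • w + Q • v) (b • (v - β • u)
        + (Q • (-((α / Q) • (v - β • u)) - D • u - (a * P) • (w + z)) + I • v))
      + b * (α - b - I) * inner ℝ w (v - β • u)
      + a * (Q ^ 2 * P) * inner ℝ (w + z) (v - β • u) =
    -(Q * (Q * D - (α - b) * β) * β * ‖u‖ ^ 2) - Q * (α - b - I) * ‖v‖ ^ 2
      - b * (Q * D - (α - b) * β) * inner ℝ u w - b * (α - b - I) * β * inner ℝ u w
      - a * b * (Q * P) * (‖w + z‖ ^ 2 + ‖w‖ ^ 2 - ‖z‖ ^ 2) / 2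
      - a * β * (Q ^ 2 * P) * (inner ℝ u w + inner ℝ u z) := by
  simp only [inner_add_left, inner_add_right, inner_sub_right, inner_neg_right, norm_add_sq_real,
    real_inner_smul_left, real_inner_smul_right, real_inner_comm v w, real_inner_comm u w,
    real_inner_comm u v, real_inner_comm z w, real_inner_comm u z, real_inner_comm z v,
    real_inner_self_eq_norm_sq]
  field_simp
  ring

theorem hasDerivAt_energy [CompleteSpace X] {g : X → ℝ} (hg : Differentiable ℝ g) {δ : ℝ → ℝ}
    {α β a p q : ℝ} (z : X) (b : ℝ) {x v : ℝ → X} {t d : ℝ} (ht : 0 < t)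
    (hx : HasDerivAt x (v t - β • gradient g (x t)) t)
    (hv : HasDerivAt v (-((α / t ^ q) • (v t - β • gradient g (x t))) - δ t • gradient g (x t)
      - (a / t ^ p) • x t) t)
    (hδ : HasDerivAt δ d t) :
    HasDerivAt (energy g δ α β a p q z b x v)
      (energyDeriv g δ α β a p q z b x v t d) t := by
  have hpow : ∀ r : ℝ, HasDerivAt (fun s : ℝ => s ^ r) (r * t ^ (r - 1)) t := fun r =>
    Real.hasDerivAt_rpow_const (Or.inl ht.ne')
  have hgx : HasDerivAt (fun s => g (x s) - g z)
      (inner ℝ (gradient g (x t)) (v t - β • gradient g (x t))) t := by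
    have := ((hg (x t)).hasFDerivAt.comp_hasDerivAt t hx).sub_const (g z)
    simpa only [inner_gradient_left] using! this
  have hw : HasDerivAt (fun s => x s - z) (v t - β • gradient g (x t)) t := hx.sub_const z
  have h1 := (((hpow (2 * q)).mul hδ).sub ((hpow q).const_mul ((α - b) * β))).mul hgx
  have h2 := ((hw.const_smul b).add ((hpow q).smul hv)).norm_sq.const_mul (1 / 2 : ℝ)
  have h3 := ((((hpow (q - 1)).const_mul q).const_sub (α - b)).const_mul b).const_mul (1 / 2 : ℝ)
  have h4 := h3.mul hw.norm_sq
  have h5 := ((hpow (2 * q - p)).const_mul (1 / 2 * a)).mul hx.norm_sq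
  have h := ((h1.add h2).add h4).add h5
  have hQ : 0 < t ^ q := Real.rpow_pos_of_pos ht q
  have e1 : t ^ (2 * q) = (t ^ q) ^ 2 := by rw [two_mul, Real.rpow_add ht, sq]
  have e2 : t ^ (2 * q - p) = (t ^ q) ^ 2 * (t ^ p)⁻¹ := by
    rw [Real.rpow_sub ht, e1, div_eq_mul_inv]
  have e3 : t ^ (q - p) = t ^ q * (t ^ p)⁻¹ := by rw [Real.rpow_sub ht, div_eq_mul_inv]
  have hid := energy_cross_terms (x t - z) z (gradient g (x t)) (v t) hQ.ne' α β a b (δ t)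
    (t ^ p)⁻¹ (q * t ^ (q - 1))
  rw [sub_add_cancel] at hid
  refine (h.congr_deriv ?_)
  unfold energyDeriv
  simp only [Pi.add_apply, Pi.sub_apply, Pi.mul_apply, Pi.smul_apply', Pi.smul_apply]
  rw [show q - 1 - 1 = q - 2 by ring, div_eq_mul_inv a, e1, e2, e3]
  linear_combination hid

end Energy

theorem tendsto_rpow_atTop_nhds_zero {r : ℝ} (hr : r < 0) :
    Tendsto (fun t : ℝ => t ^ r) atTop (𝓝 0) := by
  simpa using tendsto_rpow_neg_atTop (y := -r) (by linarith)

/-! ### Dissipation of the energy and its consequences -/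

section Lyapunov

variable {X : Type*} [NormedAddCommGroup X] [InnerProductSpace ℝ X]
  {g : X → ℝ} {α β a p q : ℝ} {δ d : ℝ → ℝ} {x v : ℝ → X} {z : X}

/-- Since `t^q δ → ∞` and `t^(q-1) → 0`, each negative correction eventually costs at most half of
its leading coefficient. -/
theorem eventually_le_energy (ha : 0 < a) (hq₀ : 0 < q) (hq₁ : q < 1)
    (hδ_lim : Tendsto δ atTop atTop) (hz : z ∈ argmin g) {b : ℝ} (hb : 0 < b) (hbα : b < α) :
    ∀ᶠ t in atTop, 1 / 2 * (t ^ (2 * q) * δ t * (g (x t) - g z))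
      + b * (α - b) / 4 * ‖x t - z‖ ^ 2 ≤ energy g δ α β a p q z b x v t := by
  have hαb : 0 < α - b := sub_pos.2 hbα
  have hQδ : Tendsto (fun t => t ^ q * δ t) atTop atTop :=
    (tendsto_rpow_atTop hq₀).atTop_mul_atTop₀ hδ_lim
  have hI : Tendsto (fun t : ℝ => q * t ^ (q - 1)) atTop (𝓝 0) := by
    simpa using (tendsto_rpow_atTop_nhds_zero (by linarith : q - 1 < 0)).const_mul q
  filter_upwards [eventually_gt_atTop 0, hQδ.eventually_ge_atTop (2 * ((α - b) * β)),
    hI.eventually (gt_mem_nhds (half_pos hαb))] with t ht h1 h2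
  have hG : 0 ≤ g (x t) - g z := sub_nonneg.2 (hz _)
  have hQ : 0 < t ^ q := Real.rpow_pos_of_pos ht q
  have e1 : t ^ (2 * q) = (t ^ q) ^ 2 := by rw [two_mul, Real.rpow_add ht, sq]
  have s1 : 1 / 2 * (t ^ (2 * q) * δ t) ≤ t ^ (2 * q) * δ t - (α - b) * β * t ^ q := by
    rw [e1]
    have := mul_le_mul_of_nonneg_left h1 hQ.le
    linarith
  have s2 := mul_le_mul_of_nonneg_right s1 hG
  have s3 : b * (α - b) / 4 * ‖x t - z‖ ^ 2 ≤
      1 / 2 * (b * (α - b - q * t ^ (q - 1))) * ‖x t - z‖ ^ 2 := by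
    refine mul_le_mul_of_nonneg_right ?_ (by positivity)
    have := mul_lt_mul_of_pos_left h2 hb
    linarith
  have s4 : 0 ≤ 1 / 2 * a * t ^ (2 * q - p) * ‖x t‖ ^ 2 := by positivity
  have s5 : 0 ≤ 1 / 2 * ‖b • (x t - z) + t ^ q • v t‖ ^ 2 := by positivity
  unfold energy
  linarith

/-- This lets the Tikhonov term absorb the contribution of the derivative of `q t^(q-1)`. The two
powers have the same order only when `p = 2`, whence the condition on `a`. -/
theorem eventually_regularization_le (ha : 0 < a) (hp₂ : p ≤ 2) (ha₂ : p = 2 → q * (1 - q) ≤ a) :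
    ∀ᶠ t : ℝ in atTop, q * (1 - q) * t ^ (q - 2) ≤ a * t ^ (q - p) := by
  rcases hp₂.eq_or_lt with rfl | hlt
  · filter_upwards [eventually_gt_atTop 0] with t ht
    exact mul_le_mul_of_nonneg_right (ha₂ rfl) (Real.rpow_nonneg ht.le _)
  · have h := ((tendsto_rpow_atTop_nhds_zero (by linarith : p - 2 < 0)).const_mul
      (q * (1 - q))).eventually (gt_mem_nhds (by simpa using ha))
    filter_upwards [h, eventually_gt_atTop 0] with t h ht
    rw [show q - 2 = (p - 2) + (q - p) by ring, Real.rpow_add ht, ← mul_assoc]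
    exact mul_le_mul_of_nonneg_right h.le (Real.rpow_nonneg ht.le _)

variable [CompleteSpace X]

/-- Pointwise dissipation estimate for the energy at a sufficiently large time. -/
theorem energyDeriv_le (hg_conv : ConvexOn ℝ univ g) (hg_diff : Differentiable ℝ g)
    (hβ : 0 < β) (ha : 0 < a) (hq₀ : 0 < q) (hq₁ : q < 1) (hp : q + 1 < p) {K : ℝ}
    (hz : z ∈ argmin g) {b : ℝ} (hb : 0 < b) (hbα : b < α) {t d : ℝ} (ht1 : 1 ≤ t)
    (hδ1 : 1 ≤ δ t) (hgr : t * d ≤ K * δ t) (h1 : 2 * ((α - b) * β) ≤ t ^ q * δ t)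
    (h2 : q * t ^ (q - 1) ≤ (α - b) / 2) (h3 : (2 * q + K) * t ^ (q - 1) ≤ b / 4)
    (h4 : q * (1 - q) * t ^ (q - 2) ≤ a * t ^ (q - p)) :
    energyDeriv g δ α β a p q z b x v t d ≤
      -(min (b / 4) (α - b) * (t ^ (2 * q) * (δ t * (g (x t) - g z) + 1 / 2 * ‖v t‖ ^ 2)
        * t ^ (-q))) + (a * b * ‖z‖ ^ 2 / 2 + β * a ^ 2 * ‖z‖ ^ 2 / 2) * t ^ (q - p) := by
  have hαb : 0 < α - b := sub_pos.2 hbα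
  unfold energyDeriv
  have ht : 0 < t := by linarith
  have hG : 0 ≤ g (x t) - g z := sub_nonneg.2 (hz _)
  have hn : g (x t) - g z ≤ inner ℝ (gradient g (x t)) (x t - z) := by
    have := hg_conv.add_inner_gradient_le (hg_diff (x t)) z
    rw [← neg_sub (x t) z, inner_neg_right] at this
    linarith
  have huz : -(‖gradient g (x t)‖ * ‖z‖) ≤ inner ℝ (gradient g (x t)) z :=
    neg_le_of_abs_le (abs_real_inner_le_norm _ _)
  set u := gradient g (x t)
  set n : ℝ := inner ℝ u (x t - z)
  set m : ℝ := inner ℝ u z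
  set G := g (x t) - g z
  set D := δ t
  have hP : 0 < t ^ (q - p) := Real.rpow_pos_of_pos ht _
  have hP1 : t ^ (q - p) ≤ 1 := Real.rpow_le_one_of_one_le_of_nonpos ht1 (by linarith)
  have hS : 0 ≤ t ^ (2 * q - p - 1) := Real.rpow_nonneg ht.le _
  have e1 : t ^ (2 * q) = (t ^ q) ^ 2 := by rw [two_mul, Real.rpow_add ht, sq]
  have e2 : t ^ (2 * q - p) = t ^ q * t ^ (q - p) := by
    rw [← Real.rpow_add ht]
    ring_nf
  have e3 : t ^ (2 * q - 1) = t ^ q * t ^ (q - 1) := by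
    rw [← Real.rpow_add ht]
    ring_nf
  have e4 : (t ^ q) ^ 2 = t ^ q * t ^ (q - 1) * t := by
    rw [sq, mul_assoc, Real.rpow_sub_one ht.ne', div_mul_cancel₀ _ ht.ne']
  have e5 : t ^ (-q) = (t ^ q)⁻¹ := Real.rpow_neg ht.le q
  have hQ : 0 < t ^ q := Real.rpow_pos_of_pos ht q
  have hI0 : 0 < t ^ (q - 1) := Real.rpow_pos_of_pos ht _
  rw [e1, e2, e3, e5]
  set Q := t ^ q
  set I := t ^ (q - 1)
  set P := t ^ (q - p)
  -- The growth bound makes this coefficient of order `t^(q-1) · t^q δ`, so it takes only half of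
  -- the `b / 2` supplied by convexity in `s4`.
  have s1 : (2 * q * (Q * I) * D + Q ^ 2 * d - (α - b) * β * (q * I)) * G ≤ b / 4 * Q * D * G := by
    refine mul_le_mul_of_nonneg_right ?_ hG
    have r1 : Q ^ 2 * d ≤ Q * I * (K * D) := by
      rw [e4, mul_assoc]
      exact mul_le_mul_of_nonneg_left hgr (by positivity)
    have r2 : 0 ≤ (α - b) * β * (q * I) := by positivity
    have r3 : (2 * q + K) * I * (Q * D) ≤ b / 4 * (Q * D) :=
      mul_le_mul_of_nonneg_right h3 (by positivity)
    linarith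
  have s2 : 1 / 2 * Q ^ 2 * β * ‖u‖ ^ 2 ≤ Q * (Q * D - (α - b) * β) * β * ‖u‖ ^ 2 := by
    have r1 : 1 / 2 * Q ≤ Q * D - (α - b) * β := by
      have := mul_le_mul_of_nonneg_left hδ1 hQ.le
      linarith
    have r2 := mul_le_mul_of_nonneg_left r1 (by positivity : 0 ≤ Q * β * ‖u‖ ^ 2)
    linarith
  have s3 : (α - b) / 2 * (Q * ‖v t‖ ^ 2) ≤ Q * (α - b - q * I) * ‖v t‖ ^ 2 := by
    have := mul_le_mul_of_nonneg_right h2 (by positivity : 0 ≤ Q * ‖v t‖ ^ 2)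
    linarith
  have s4 : b / 2 * Q * D * G ≤ b * (Q * D - (α - b) * β) * n := by
    have r1 : b / 2 * Q * D ≤ b * (Q * D - (α - b) * β) := by
      have := mul_le_mul_of_nonneg_left h1 hb.le
      linarith
    exact mul_le_mul r1 hn hG (le_trans (by positivity) r1)
  have hn0 : 0 ≤ n := hG.trans hn
  have s5 : 0 ≤ b * (α - b - q * I) * β * n := by
    have : 0 ≤ α - b - q * I := by linarith
    positivity
  have s6 : -(a * b * P * (‖x t‖ ^ 2 + ‖x t - z‖ ^ 2 - ‖z‖ ^ 2) / 2)
      + b * q * (1 - q) * t ^ (q - 2) * ‖x t - z‖ ^ 2 / 2 ≤ a * b * ‖z‖ ^ 2 / 2 * P := by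
    have r1 := mul_le_mul_of_nonneg_right h4 (by positivity : 0 ≤ b * ‖x t - z‖ ^ 2 / 2)
    have r2 : 0 ≤ a * b * P * ‖x t‖ ^ 2 / 2 := by positivity
    linarith
  have s7 : 0 ≤ a * (p - 2 * q) * t ^ (2 * q - p - 1) * ‖x t‖ ^ 2 / 2 := by
    have : 0 ≤ p - 2 * q := by linarith
    positivity
  -- Young's inequality: the gradient dissipation from `s2` pays for the product `‖u‖ ‖z‖`, leaving
  -- a multiple of `P² ≤ P`.
  have s8 : -(a * β * (Q * P) * (n + m)) ≤
      1 / 2 * Q ^ 2 * β * ‖u‖ ^ 2 + β * a ^ 2 * ‖z‖ ^ 2 / 2 * P := by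
    have r1 : a * β * (Q * P) * -(‖u‖ * ‖z‖) ≤ a * β * (Q * P) * (n + m) :=
      mul_le_mul_of_nonneg_left (by linarith) (by positivity)
    have r2 : β * a ^ 2 * ‖z‖ ^ 2 / 2 * (P * P) ≤ β * a ^ 2 * ‖z‖ ^ 2 / 2 * P :=
      mul_le_mul_of_nonneg_left (mul_le_of_le_one_left hP.le hP1) (by positivity)
    have r3 : 0 ≤ β * (Q * ‖u‖ - a * P * ‖z‖) ^ 2 := by positivity
    linarith
  have s9 : min (b / 4) (α - b) * (Q ^ 2 * (D * G + 1 / 2 * ‖v t‖ ^ 2) * Q⁻¹) ≤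
      b / 4 * Q * D * G + (α - b) / 2 * (Q * ‖v t‖ ^ 2) := by
    have r0 : Q ^ 2 * (D * G + 1 / 2 * ‖v t‖ ^ 2) * Q⁻¹ = Q * D * G + Q * (1 / 2 * ‖v t‖ ^ 2) := by
      field_simp
    have r1 := mul_le_mul_of_nonneg_right (min_le_left (b / 4) (α - b))
      (by positivity : 0 ≤ Q * D * G)
    have r2 := mul_le_mul_of_nonneg_right (min_le_right (b / 4) (α - b))
      (by positivity : 0 ≤ Q * (1 / 2 * ‖v t‖ ^ 2))
    rw [r0]
    linarith
  linarith

/-- The energy dissipates at a rate controlled by the kinetic-potential part, up to an integrable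
error. -/
theorem exists_energy_deriv_le (hg_conv : ConvexOn ℝ univ g) (hg_diff : Differentiable ℝ g)
    (hβ : 0 < β) (ha : 0 < a) (hq₀ : 0 < q) (hq₁ : q < 1) (hp : q + 1 < p)
    (hp₂ : p ≤ 2) (ha₂ : p = 2 → q * (1 - q) ≤ a) (hδ_lim : Tendsto δ atTop atTop)
    (hδ : ∀ᶠ t in atTop, HasDerivAt δ (d t) t) {K : ℝ}
    (hδ_growth : ∀ᶠ t in atTop, t * d t < K * δ t)
    (hx : ∀ᶠ t in atTop, HasDerivAt x (v t - β • gradient g (x t)) t)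
    (hv : ∀ᶠ t in atTop, HasDerivAt v (-((α / t ^ q) • (v t - β • gradient g (x t)))
      - δ t • gradient g (x t) - (a / t ^ p) • x t) t)
    (hz : z ∈ argmin g) {b : ℝ} (hb : 0 < b) (hbα : b < α) :
    ∃ (E' : ℝ → ℝ) (κ C : ℝ), 0 < κ ∧ 0 ≤ C ∧
      (∀ᶠ t in atTop, HasDerivAt (energy g δ α β a p q z b x v) (E' t) t) ∧
      ∀ᶠ t in atTop, E' t ≤
        -(κ * (t ^ (2 * q) * (δ t * (g (x t) - g z) + 1 / 2 * ‖v t‖ ^ 2) * t ^ (-q)))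
          + C * t ^ (q - p) := by
  have hαb : 0 < α - b := sub_pos.2 hbα
  have hQδ : Tendsto (fun t => t ^ q * δ t) atTop atTop :=
    (tendsto_rpow_atTop hq₀).atTop_mul_atTop₀ hδ_lim
  have hI : ∀ c : ℝ, Tendsto (fun t : ℝ => c * t ^ (q - 1)) atTop (𝓝 0) := fun c => by
    simpa using (tendsto_rpow_atTop_nhds_zero (by linarith : q - 1 < 0)).const_mul c
  refine ⟨fun t => energyDeriv g δ α β a p q z b x v t (d t), min (b / 4) (α - b),
    a * b * ‖z‖ ^ 2 / 2 + β * a ^ 2 * ‖z‖ ^ 2 / 2,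
    by positivity, by positivity, ?_, ?_⟩
  · filter_upwards [eventually_gt_atTop 0, hx, hv, hδ] with t ht h1 h2 h3
    exact hasDerivAt_energy hg_diff z b ht h1 h2 h3
  filter_upwards [eventually_ge_atTop 1, hδ_lim.eventually_ge_atTop 1, hδ_growth,
    hQδ.eventually_ge_atTop (2 * ((α - b) * β)), (hI q).eventually (gt_mem_nhds (half_pos hαb)),
    (hI (2 * q + K)).eventually (gt_mem_nhds (by positivity : (0 : ℝ) < b / 4)),
    eventually_regularization_le ha hp₂ ha₂] with t ht1 hδ1 hgr h1 h2 h3 h4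
  exact energyDeriv_le hg_conv hg_diff hβ ha hq₀ hq₁ hp hz hb hbα ht1 hδ1 hgr.le h1 h2.le h3.le h4

theorem tendsto_of_energy (hg_conv : ConvexOn ℝ univ g) (hg_diff : Differentiable ℝ g)
    (hα : 0 < α) (hβ : 0 < β) (ha : 0 < a) (hq₀ : 0 < q) (hq₁ : q < 1) (hp : q + 1 < p)
    (hp₂ : p ≤ 2) (ha₂ : p = 2 → q * (1 - q) ≤ a) (hδ_lim : Tendsto δ atTop atTop)
    (hδ : ∀ᶠ t in atTop, HasDerivAt δ (d t) t) {K : ℝ}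
    (hδ_growth : ∀ᶠ t in atTop, t * d t < K * δ t)
    (hx : ∀ᶠ t in atTop, HasDerivAt x (v t - β • gradient g (x t)) t)
    (hv : ∀ᶠ t in atTop, HasDerivAt v (-((α / t ^ q) • (v t - β • gradient g (x t)))
      - δ t • gradient g (x t) - (a / t ^ p) • x t) t)
    (hz : z ∈ argmin g) :
    (∃ r, Tendsto (fun t => ‖x t - z‖ ^ 2) atTop (𝓝 r)) ∧
      Tendsto (fun t => t ^ (2 * q) * δ t * (g (x t) - g z)) atTop (𝓝 0) ∧
      Tendsto (fun t => t ^ q * ‖v t‖) atTop (𝓝 0) := by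
  have hQ := tendsto_rpow_atTop hq₀
  have hG : ∀ t, 0 ≤ g (x t) - g z := fun t => sub_nonneg.2 (hz _)
  have hδ0 : ∀ᶠ t in atTop, 0 < δ t := hδ_lim.eventually_gt_atTop 0
  set W : ℝ → ℝ := fun t => t ^ (2 * q) * (δ t * (g (x t) - g z) + 1 / 2 * ‖v t‖ ^ 2) with hW
  have hW0 : ∀ᶠ t in atTop, 0 ≤ W t := by
    filter_upwards [hδ0, eventually_gt_atTop 0] with t h1 h2
    have := hG t
    positivity
  have hnonneg : ∀ b, 0 < b → b < α → ∀ᶠ t in atTop, 0 ≤ energy g δ α β a p q z b x v t := by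
    intro b hb hbα
    filter_upwards [eventually_le_energy (β := β) (p := p) (x := x) (v := v) ha hq₀ hq₁ hδ_lim hz
      hb hbα, hδ0, eventually_gt_atTop 0] with t h1 h2 h3
    have := hG t
    have := sub_pos.2 hbα
    exact le_trans (by positivity) h1
  have hconv : ∀ b, 0 < b → b < α →
      ∃ L, Tendsto (energy g δ α β a p q z b x v) atTop (𝓝 L) := by
    intro b hb hbα
    obtain ⟨E', κ, C, hκ, hC, hE, hE'⟩ := exists_energy_deriv_le hg_conv hg_diff hβ ha hq₀ hq₁ hp
      hp₂ ha₂ hδ_lim hδ hδ_growth hx hv hz hb hbα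
    refine exists_tendsto_of_deriv_le_rpow (by linarith : q - p < -1) hC hE ?_ (hnonneg b hb hbα)
    filter_upwards [hE', hW0, eventually_gt_atTop 0] with t h1 h2 h3
    have h4 : 0 ≤ κ * (W t * t ^ (-q)) := by positivity
    exact h1.trans (add_le_of_nonpos_left (neg_nonpos.2 h4))
  have hb₁ : 0 < α / 3 := by positivity
  have hb₁' : α / 3 < α := by linarith
  obtain ⟨L₁, hL₁⟩ := hconv (α / 3) hb₁ hb₁'
  -- Any two distinct parameters in `(0, α)` would do.
  obtain ⟨L₂, hL₂⟩ := hconv (2 * α / 3) (by positivity) (by linarith)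
  have hbd : ∀ᶠ t in atTop, energy g δ α β a p q z (α / 3) x v t < L₁ + 1 :=
    hL₁.eventually (gt_mem_nhds (lt_add_one L₁))
  have hlow := eventually_le_energy (β := β) (p := p) (x := x) (v := v) ha hq₀ hq₁ hδ_lim hz
    hb₁ hb₁'
  obtain ⟨M, hM0, hM⟩ : ∃ M, 0 ≤ M ∧ ∀ᶠ t in atTop, ‖x t - z‖ ^ 2 ≤ M := by
    refine ⟨|(L₁ + 1) / (α / 3 * (α - α / 3) / 4)|, abs_nonneg _, ?_⟩
    filter_upwards [hbd, hlow, hδ0, eventually_gt_atTop 0] with t h1 h2 h3 h4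
    refine le_trans ?_ (le_abs_self _)
    have hc : 0 < α / 3 * (α - α / 3) / 4 := by
      have := sub_pos.2 hb₁'
      positivity
    rw [le_div_iff₀ hc]
    have := hG t
    have : 0 ≤ 1 / 2 * (t ^ (2 * q) * δ t * (g (x t) - g z)) := by positivity
    linarith
  -- Boundedness of `t^(2q) δ (g(x) - g(z))` is enough here, after division by `t^q δ → ∞`.
  have hQG : Tendsto (fun t => t ^ q * (g (x t) - g z)) atTop (𝓝 0) := by
    have hinv : Tendsto (fun t => 2 * (L₁ + 1) * (t ^ q * δ t)⁻¹) atTop (𝓝 0) := by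
      simpa using (hQ.atTop_mul_atTop₀ hδ_lim).inv_tendsto_atTop.const_mul (2 * (L₁ + 1))
    refine squeeze_zero' ?_ ?_ hinv
    · filter_upwards [eventually_gt_atTop 0] with t ht
      exact mul_nonneg (Real.rpow_nonneg ht.le q) (hG t)
    · filter_upwards [hbd, hlow, hδ0, eventually_gt_atTop 0] with t h1 h2 h3 h4
      have hQt : 0 < t ^ q := Real.rpow_pos_of_pos h4 q
      rw [← div_eq_mul_inv, le_div_iff₀ (by positivity)]
      rw [two_mul q, Real.rpow_add h4] at h2
      have := sub_pos.2 hb₁'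
      have : 0 ≤ α / 3 * (α - α / 3) / 4 * ‖x t - z‖ ^ 2 := by positivity
      linarith
  have hreg : Tendsto (fun t => t ^ (2 * q - p) * ‖x t‖ ^ 2) atTop (𝓝 0) := by
    have h0 : Tendsto (fun t : ℝ => t ^ (2 * q - p) * (2 * (M + ‖z‖ ^ 2))) atTop (𝓝 0) := by
      simpa using (tendsto_rpow_atTop_nhds_zero (by linarith : 2 * q - p < 0)).mul_const
        (2 * (M + ‖z‖ ^ 2))
    refine squeeze_zero' ?_ ?_ h0
    · filter_upwards [eventually_gt_atTop 0] with t ht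
      positivity
    · filter_upwards [hM, eventually_gt_atTop 0] with t h1 h2
      refine mul_le_mul_of_nonneg_left ?_ (Real.rpow_nonneg h2.le _)
      have h3 : ‖x t‖ ≤ ‖x t - z‖ + ‖z‖ := by simpa using norm_add_le (x t - z) z
      have h4 : ‖x t‖ ^ 2 ≤ (‖x t - z‖ + ‖z‖) ^ 2 := by gcongr
      linarith [sq_nonneg (‖x t - z‖ - ‖z‖)]
  have hIw : Tendsto (fun t => t ^ (q - 1) * ‖x t - z‖ ^ 2) atTop (𝓝 0) := by
    have h0 : Tendsto (fun t : ℝ => t ^ (q - 1) * M) atTop (𝓝 0) := by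
      simpa using (tendsto_rpow_atTop_nhds_zero (by linarith : q - 1 < 0)).mul_const M
    refine squeeze_zero' ?_ ?_ h0
    · filter_upwards [eventually_gt_atTop 0] with t ht
      positivity
    · filter_upwards [hM, eventually_gt_atTop 0] with t h1 h2
      exact mul_le_mul_of_nonneg_left h1 (Real.rpow_nonneg h2.le _)
  set B : ℝ → ℝ := fun t => β * (t ^ q * (g (x t) - g z)) + t ^ q * inner ℝ (x t - z) (v t)
    + 1 / 2 * (α - q * t ^ (q - 1)) * ‖x t - z‖ ^ 2 with hB
  -- The `b²` terms from the squared norm and from the weight `b (α - b - q t^(q-1))` cancel, so the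
  -- energy is affine in `b` with slope `B`.
  have hexp : ∀ b t, 0 < t → energy g δ α β a p q z b x v t = W t + b * B t
      - α * β * (t ^ q * (g (x t) - g z)) + 1 / 2 * a * (t ^ (2 * q - p) * ‖x t‖ ^ 2) := by
    intro b t ht
    have e1 : t ^ (2 * q) = (t ^ q) ^ 2 := by rw [two_mul, Real.rpow_add ht, sq]
    simp only [energy, hW, hB, norm_add_sq_real, real_inner_smul_left, real_inner_smul_right,
      norm_smul, mul_pow, Real.norm_eq_abs, sq_abs, e1]
    ring
  have hBlim : Tendsto B atTop (𝓝 ((L₂ - L₁) / (α / 3))) := by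
    refine ((hL₂.sub hL₁).div_const (α / 3)).congr' ?_
    filter_upwards [eventually_gt_atTop 0] with t ht
    rw [hexp _ t ht, hexp _ t ht, div_eq_iff hb₁.ne']
    ring
  obtain ⟨LW, hWL⟩ : ∃ LW, Tendsto W atTop (𝓝 LW) := by
    refine ⟨_, (((hL₁.sub (hBlim.const_mul (α / 3))).add (hQG.const_mul (α * β))).sub
      (hreg.const_mul (1 / 2 * a))).congr' ?_⟩
    filter_upwards [eventually_gt_atTop 0] with t ht
    rw [hexp _ t ht]
    ring
  have hLW : LW = 0 := by
    obtain ⟨E', κ, C, hκ, hC, hE, hE'⟩ := exists_energy_deriv_le hg_conv hg_diff hβ ha hq₀ hq₁ hp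
      hp₂ ha₂ hδ_lim hδ hδ_growth hx hv hz hb₁ hb₁'
    exact le_antisymm (limit_nonpos_of_deriv_le (by linarith : q - p < -1) hq₁ hκ hE hE'
      (hnonneg _ hb₁ hb₁') hL₁ hWL) (ge_of_tendsto hWL hW0)
  rw [hLW] at hWL
  have hv0 : Tendsto (fun t => t ^ q * ‖v t‖) atTop (𝓝 0) := by
    have h1 : Tendsto (fun t => √(2 * W t)) atTop (𝓝 0) := by
      simpa using (hWL.const_mul 2).sqrt
    refine squeeze_zero' ?_ ?_ h1
    · filter_upwards [eventually_gt_atTop 0] with t ht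
      positivity
    · filter_upwards [hδ0, eventually_gt_atTop 0] with t h2 h3
      refine Real.le_sqrt_of_sq_le ?_
      have := hG t
      have h4 : 0 ≤ t ^ (2 * q) * (δ t * (g (x t) - g z)) := by positivity
      have h5 : (t ^ q * ‖v t‖) ^ 2 = t ^ (2 * q) * ‖v t‖ ^ 2 := by
        rw [mul_pow, two_mul, Real.rpow_add h3, sq (t ^ q)]
      simp only [hW]
      linarith
  refine ⟨?_, ?_, hv0⟩
  · have hcross : Tendsto (fun t => t ^ q * inner ℝ (x t - z) (v t)) atTop (𝓝 0) := by
      refine squeeze_zero_norm' ?_ (by simpa using hv0.const_mul (M + 1))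
      filter_upwards [hM, eventually_gt_atTop 0] with t h1 h2
      have hQt : 0 < t ^ q := Real.rpow_pos_of_pos h2 q
      have h3 : ‖x t - z‖ ≤ M + 1 := by
        nlinarith [sq_nonneg (‖x t - z‖ - 1), norm_nonneg (x t - z)]
      calc ‖t ^ q * inner ℝ (x t - z) (v t)‖ = t ^ q * ‖inner ℝ (x t - z) (v t)‖ := by
            rw [norm_mul, Real.norm_of_nonneg hQt.le]
        _ ≤ t ^ q * (‖x t - z‖ * ‖v t‖) := by
            gcongr
            exact norm_inner_le_norm _ _
        _ ≤ t ^ q * ((M + 1) * ‖v t‖) := by gcongr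
        _ = (M + 1) * (t ^ q * ‖v t‖) := by ring
    -- Solve the definition of `B` for `‖x - z‖²`; every other term has a limit.
    refine ⟨_, ((((hBlim.sub (hQG.const_mul β)).sub hcross).add
      (hIw.const_mul (q / 2))).const_mul (2 / α)).congr fun t => ?_⟩
    simp only [hB]
    field_simp
    ring
  · refine squeeze_zero' ?_ ?_ hWL
    · filter_upwards [hδ0, eventually_gt_atTop 0] with t h1 h2
      have := hG t
      positivity
    · filter_upwards [eventually_gt_atTop 0] with t ht
      have : 0 ≤ t ^ (2 * q) * (1 / 2 * ‖v t‖ ^ 2) := by positivity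
      simp only [hW]
      linarith

end Lyapunov

/-! ### The main theorem -/

theorem theorem3p3 {X : Type*} [NormedAddCommGroup X] [InnerProductSpace ℝ X] [CompleteSpace X]
    (g : X → ℝ) (hg_conv : ConvexOn ℝ univ g) (hg_diff : Differentiable ℝ g)
    (hg_min : (argmin g).Nonempty)
    (α β a p q t₀ : ℝ) (hα : 0 < α) (hβ : 0 < β) (ha : 0 < a) (ht₀ : 0 < t₀)
    (hq₀ : 0 < q) (hq₁ : q < 1) (hp : q + 1 < p) (hp₂ : p ≤ 2)
    (ha₂ : p = 2 → q * (1 - q) ≤ a)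
    (δ : ℝ → ℝ) (hδ_pos : ∀ t, t₀ ≤ t → 0 < δ t) (hδ_mono : MonotoneOn δ (Ici t₀))
    (hδ_diff : DifferentiableOn ℝ δ (Ici t₀)) (hδ_lim : Tendsto δ atTop atTop)
    (hδ_growth : ∃ K₁ : ℝ, 0 < K₁ ∧ ∀ᶠ t in atTop, t * timeDeriv t₀ δ t < K₁ * δ t)
    (x : ℝ → X) (hx : IsStrongGlobalSolution g δ α β a p q t₀ x) :
    (∃ z ∈ argmin g,
      Tendsto (fun t => toWeakSpace ℝ X (x t)) atTop (𝓝 (toWeakSpace ℝ X z))) ∧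
    ∀ z ∈ argmin g,
      (fun t => g (x t) - g z) =o[atTop] (fun t => 1 / (δ t * t ^ (2 * q))) ∧
      (fun t => ‖timeDeriv t₀ x t + β • gradient g (x t)‖) =o[atTop] (fun t => 1 / t ^ q) := by
  obtain ⟨K, -, hgrowth⟩ := hδ_growth
  set v : ℝ → X := fun t => timeDeriv t₀ x t + β • gradient g (x t) with hv_def
  have hxv : ∀ t, v t - β • gradient g (x t) = timeDeriv t₀ x t := fun t => add_sub_cancel_right _ _
  have hδ' : ∀ᶠ t in atTop, HasDerivAt δ (timeDeriv t₀ δ t) t := by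
    filter_upwards [eventually_gt_atTop t₀] with t ht using hδ_diff.hasDerivAt_timeDeriv ht
  have hx' : ∀ᶠ t in atTop, HasDerivAt x (v t - β • gradient g (x t)) t := by
    filter_upwards [eventually_gt_atTop t₀] with t ht
    rw [hxv]
    exact hx.differentiable.hasDerivAt_timeDeriv ht
  have hv' : ∀ᶠ t in atTop, HasDerivAt v (-((α / t ^ q) • (v t - β • gradient g (x t)))
      - δ t • gradient g (x t) - (a / t ^ p) • x t) t := by
    filter_upwards [eventually_gt_atTop t₀] with t ht
    rw [hxv]
    exact hx.hasDerivAt_velocity_add_gradient ht₀ hδ_diff.continuousOn ht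
  have key := fun z (hz : z ∈ argmin g) => tendsto_of_energy hg_conv hg_diff hα hβ ha hq₀ hq₁ hp
    hp₂ ha₂ hδ_lim hδ' hgrowth hx' hv' hz
  have hδ0 : ∀ᶠ t in atTop, 1 ≤ δ t := hδ_lim.eventually_ge_atTop 1
  constructor
  · refine exists_tendsto_toWeakSpace_of_opial hg_min (fun z hz => (key z hz).1) fun U w hU hw => ?_
    obtain ⟨z, hz⟩ := hg_min
    -- Eventually `t^(2q) δ ≥ 1`, so the weighted rate already forces `g(x) → min g`.
    have hgz : Tendsto (fun t => g (x t) - g z) atTop (𝓝 0) := by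
      refine squeeze_zero' (Eventually.of_forall fun t => sub_nonneg.2 (hz _)) ?_ (key z hz).2.1
      filter_upwards [hδ0, eventually_ge_atTop 1] with t h1 h2
      have h3 : 1 ≤ t ^ (2 * q) := Real.one_le_rpow h2 (by positivity)
      exact le_mul_of_one_le_left (sub_nonneg.2 (hz _)) (one_le_mul_of_one_le_of_one_le h3 h1)
    refine mem_argmin_of_weak_limit hg_conv hg_diff hz ?_ hw
    simpa using (hgz.add_const (g z)).mono_left hU
  · intro z hz
    obtain ⟨-, h1, h2⟩ := key z hz
    constructor
    · refine (isLittleO_iff_tendsto' ?_).2 (h1.congr fun t => ?_)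
      · filter_upwards [hδ0, eventually_gt_atTop 0] with t h3 h4 h5
        have : 0 < 1 / (δ t * t ^ (2 * q)) := by positivity
        exact absurd h5 this.ne'
      · rw [div_div_eq_mul_div, div_one]
        ring
    · refine (isLittleO_iff_tendsto' ?_).2 (h2.congr fun t => ?_)
      · filter_upwards [eventually_gt_atTop 0] with t h4 h5
        have : 0 < 1 / t ^ q := by positivity
        exact absurd h5 this.ne'
      · rw [div_div_eq_mul_div, div_one, mul_comm]
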